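/- **Setting.** A (disjunctive) program $\Pi$ is a finite set of rules $r$ with head $H_r$, positive body $B_r^+$ and negative body $B_r^-$ (pairwise disjoint finite sets of atoms); $\mathrm{at}(r)=H_r\cup B^+_r\cup B^-_r$, $\mathrm{at}(\Pi)=\bigcup_{r\in\Pi}\mathrm{at}(r)$. An answer set of $\Pi$ is a minimal model $I$ of the Gelfond–Lifschitz reduct $\Pi^I$. An instance of $\#\mathrm{PAS}$ is a pair $(\Pi,P)$ with $P\subseteq \mathrm{at}(\Pi)$; its *projected answer sets count* is the number of sets $I\subseteq P$ such that $I\cup J$ is an answer set of $\Pi$ for some $J\subseteq\mathrm{at}(\Pi)\setminus P$. The primal graph $G_\Pi$ has vertex set $\mathrm{at}(\Pi)$, two distinct atoms being adjacent iff they occur together in a rule. Let $(T,\chi)$ be a nice tree decomposition of $G_\Pi$ with root $n$ (every node is a leaf, introduce, remove or join node, join nodes have non-empty bags, and root and leaf bags are empty), and let $t_1,\dots,t_\ell$ be the children of $t$. Put $\Pi_t=\{r\in\Pi:\mathrm{at}(r)\subseteq\chi(t)\}$, and let $\Pi_{\le t}$ and $\mathrm{at}_{\le t}$ be the unions of the $\Pi_{t'}$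 and of the $\chi(t')$ over the nodes $t'$ of the subtree rooted at $t$. **First pass.** A table algorithm $\mathbb A$ computes, at a node $t$, a finite set of rows (a table) from $t$, $\chi(t)$, $(\Pi_t,P)$, an input table for $t$ and the tables of the children of $t$; the first component $\mathcal I(u)$ of a row $u$ is a set of atoms. $\mathtt{DP}_{\mathbb A}$ applies $\mathbb A$ bottom-up with empty input tables, which gives the table mapping $\tau$. For a row $u$, $\mathrm{orig}(t,u)$ is the set of $s\in\tau(t_1)\times\dots\times\tau(t_\ell)$ such that $\mathbb A$ run at $t$ on the child tables $\{s_1\},\dots,\{s_\ell\}$ produces a table containing $u$; $\mathrm{origs}(t,\rho)=\bigcup_{u\in\rho}\mathrm{orig}(t,u)$. The set $\mathrm{Ext}_{\le t}(u)$ of extensions of $u$ below $t$ is $\{\{(t,u)\}\}$ if $t$ is a leaf, and otherwise consists of all $\{(t,u)\}\cup X_1\cup\dots\cup X_\ell$ with $s\in\mathrm{orig}(t,u)$ and $X_j\in\mathrm{Ext}_{\le t_j}(s_j)$ for every $j$. Let $\mathrm{PExt}_{\le t}$ be the set of all $X\in\bigcup_{u\in\tau(t)}\mathrm{Ext}_{\le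 t}(u)$ that are contained in some $Y\in\bigcup_{u\in\tau(n)}\mathrm{Ext}_{\le n}(u)$; let $\mathcal I(\mathrm{PExt}_{\le t})=\{\bigcup_{(t',u)\in X}\mathcal I(u): X\in\mathrm{PExt}_{\le t}\}$; and let the purged table $\nu(t)$ be the set of rows $u$ of $\tau(t)$ such that $(t,u)\in X$ for some $X\in\mathrm{PExt}_{\le t}$. **Admissibility.** $\mathbb A$ is *admissible on* $(\Pi,P)$ and $(T,\chi)$ if for all nodes $t$: (1) $\mathcal I(u)\subseteq\chi(t)$ for all $u\in\tau(t)$; (2) $\mathcal I(s_j)\cap\chi(t_j)\cap\chi(t)=\mathcal I(u)\cap\chi(t_j)\cap\chi(t)$ for all $u\in\tau(t)$, $s\in\mathrm{orig}(t,u)$ and all $j$; (3) $\mathcal I(\mathrm{PExt}_{\le t})$ is the set of all $I\subseteq\mathrm{at}_{\le t}$ such that $I\models\Pi_{\le t}$ and there is an answer set $I'$ of $\Pi$ with $I\subseteq I'\subseteq I\cup(\mathrm{at}(\Pi)\setminus\mathrm{at}_{\le t})$; (4) if $t=n$ or $t$ is a leaf, at most one row $u$ satisfies $(t,u)\in X$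 for some $X\in\mathrm{PExt}_{\le t}$. $\mathbb A$ is *admissible for a class $\mathcal C$ of programs* if it is admissible on every instance $(\Pi,P)$ with $\Pi\in\mathcal C$ and every nice tree decomposition of $G_\Pi$. **Second pass.** $\mathtt{DP}_{\mathtt{PROJ}}$ computes bottom-up $\pi(t)=\{(\rho,\mathrm{ipmc}(t,\rho)):\rho\in\mathrm{subbuckets}_P(\nu(t))\}$. Here $\mathrm{subbuckets}_P(\nu(t))$ is the set of non-empty subsets of the classes of $\nu(t)$ under the relation $\mathcal I(u)\cap P=\mathcal I(v)\cap P$. Further, $\mathrm{ipmc}(t,\rho)=1$ if $t$ is a leaf, and otherwise $$\mathrm{ipmc}(t,\rho)=\Bigl|\,\mathrm{pmc}(t,\rho)+\sum_{\emptyset\subsetneq\varphi\subsetneq\rho}(-1)^{|\varphi|}\,\mathrm{ipmc}(t,\varphi)\Bigr|,$$ $$\mathrm{pmc}(t,\rho)=\sum_{\emptyset\subsetneq O\subseteq \mathrm{origs}(t,\rho)}(-1)^{|O|-1}\prod_{j=1}^{\ell}\mathrm{sipmc}\bigl(\pi(t_j),\{s_j:s\in O\}\bigr),$$ where $\mathrm{sipmc}(\pi(t),\rho)=\sum_{(\rho,c)\in\pi(t)}c$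 is the stored count. **Theorem.** Let $\mathbb A$ be a table algorithm. (a) For every instance $(\Pi,P)$ and every nice tree decomposition $(T,\chi)$ of $G_\Pi$ on which $\mathbb A$ is admissible, the mapping $\pi$ that $\mathtt{DP}_{\mathtt{PROJ}}$ returns on the purged tabled tree decomposition $(T,\chi,\nu)$ satisfies: the count stored at the root, $\mathrm{sipmc}(\pi(n),\nu(n))$, and also the sum of the counts $c$ of all rows $(\rho,c)\in\pi(n)$, equal the projected answer sets count of $\Pi$ with respect to $P$. (b) Consequently, if $\mathbb A$ is admissible for a class $\mathcal C$ of programs, then the algorithm $\mathtt{MDP}_{\mathbb A}$ (compute, by any procedure, a nice tree decomposition of $G_\Pi$; run $\mathtt{DP}_{\mathbb A}$; purge; run $\mathtt{DP}_{\mathtt{PROJ}}$; output the sum of the counts in $\pi(n)$) outputs the projected answer sets count for every instance $(\Pi,P)$ with $\Pi\in\mathcal C$. -/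

import Mathlib

open scoped Classical

noncomputable section

namespace PAS

universe u v w

/-! ### Disjunctive answer set programs -/

/-- A rule `a₁ ∨ ⋯ ∨ aₗ ← aₗ₊₁, …, aₘ, ¬aₘ₊₁, …, ¬aₙ` over pairwise distinct atoms. -/
structure Rule (α : Type u) where
  head : Finset α
  pos : Finset α
  neg : Finset α
  head_pos : Disjoint head pos
  head_neg : Disjoint head neg
  pos_neg : Disjoint pos neg

/-- The atoms of a rule. -/
def Rule.atoms {α : Type u} (r : Rule α) : Finset α := r.head ∪ r.pos ∪ r.neg

/-- A program is a finite set of rules. -/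
abbrev Program (α : Type u) := Finset (Rule α)

/-- The atoms of a program. -/
def atoms {α : Type u} (p : Program α) : Finset α := p.biUnion Rule.atoms

/-- The interpretation `I` satisfies the rule `r`. -/
def Rule.Sat {α : Type u} (r : Rule α) (I : Finset α) : Prop :=
  ((r.head ∪ r.neg) ∩ I).Nonempty ∨ (r.pos \ I).Nonempty

/-- `I` is a model of `p`. -/
def IsModel {α : Type u} (p : Program α) (I : Finset α) : Prop := ∀ r ∈ p, r.Sat I

/-- The rule without its negative body. -/
def Rule.positive {α : Type u} (r : Rule α) : Rule α where
  head := r.head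
  pos := r.pos
  neg := ∅
  head_pos := r.head_pos
  head_neg := Finset.disjoint_empty_right _
  pos_neg := Finset.disjoint_empty_right _

/-- The Gelfond-Lifschitz reduct of `p` under `I`. -/
def reduct {α : Type u} (p : Program α) (I : Finset α) : Program α :=
  (p.filter fun r => r.neg ∩ I = ∅).image Rule.positive

/-- `I` is an answer set of `p`: a (subset-)minimal model of the reduct of `p` under `I`. -/
def IsAnswerSet {α : Type u} (p : Program α) (I : Finset α) : Prop :=
  IsModel (reduct p I) I ∧ ∀ J : Finset α, J ⊂ I → ¬ IsModel (reduct p I) J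

/-- An instance of projected answer set counting: a program and a set of projection atoms. -/
structure Instance (α : Type u) where
  prog : Program α
  proj : Finset α
  proj_subset : proj ⊆ atoms prog

/-- The projected answer sets count: the number of sets `I ⊆ P` such that `I ∪ J` is an answer set
for some set `J` of non-projection atoms. -/
def projectedCount {α : Type u} (i : Instance α) : ℕ :=
  (i.proj.powerset.filter fun I =>
    ∃ J : Finset α, J ⊆ atoms i.prog \ i.proj ∧ IsAnswerSet i.prog (I ∪ J)).card

/-- The primal graph: its vertices are the atoms of `p`; two distinct atoms are adjacent if they
occur together in a rule. -/
def primalGraph {α : Type u} (p : Program α) : (⊤ : SimpleGraph α).Subgraph where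
  verts := {a | a ∈ atoms p}
  Adj a b := a ≠ b ∧ ∃ r ∈ p, a ∈ r.atoms ∧ b ∈ r.atoms
  adj_sub h := h.1
  edge_vert := by
    rintro a b ⟨_, r, hr, ha, _⟩
    exact Finset.mem_biUnion.2 ⟨r, hr, ha⟩
  symm := ⟨by
    rintro a b ⟨hne, r, hr, ha, hb⟩
    exact ⟨hne.symm, r, hr, hb, ha⟩⟩

/-! ### Rooted trees with bags, nice tree decompositions -/

/-- A finite rooted tree (every node has an ordered sequence of children; every node is reached
from the root; the root is nobody's child; every other node is a child in exactly one way) whose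
nodes are labelled by bags. -/
structure BagTree (α : Type u) where
  Node : Type
  fintypeNode : Fintype Node
  root : Node
  arity : Node → ℕ
  child : (t : Node) → Fin (arity t) → Node
  child_injective : Function.Injective fun x : (Σ t : Node, Fin (arity t)) => child x.1 x.2
  child_ne_root : ∀ t i, child t i ≠ root
  reachable : ∀ t, Relation.ReflTransGen (fun a b => ∃ i, b = child a i) root t
  bag : Node → Finset α

attribute [instance] BagTree.fintypeNode

namespace BagTree

variable {α : Type u} (T : BagTree α)

/-- `T.IsChild b a`: the node `b` is a child of the node `a`. -/
def IsChild (b a : T.Node) : Prop := ∃ i, b = T.child a i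

/-- The nodes of the sub-tree rooted at `t`. -/
def below (t : T.Node) : Finset T.Node :=
  Finset.univ.filter fun s => Relation.ReflTransGen (fun a b => T.IsChild b a) t s

/-- The underlying undirected graph of the tree. -/
def graph : SimpleGraph T.Node := SimpleGraph.fromRel fun a b => T.IsChild b a

/-- `T` is a tree decomposition of `G`. -/
structure IsTreeDecomposition (G : (⊤ : SimpleGraph α).Subgraph) : Prop where
  bags_cover : {a | ∃ t, a ∈ T.bag t} = G.verts
  edge_cover : ∀ a b, G.Adj a b → ∃ t, a ∈ T.bag t ∧ b ∈ T.bag t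
  path_inter : ∀ (r s t : T.Node) (q : T.graph.Walk r t), q.IsPath → s ∈ q.support →
    T.bag r ∩ T.bag t ⊆ T.bag s

def IsLeaf (t : T.Node) : Prop := T.arity t = 0

def IsJoin (t : T.Node) : Prop :=
  T.arity t = 2 ∧ (∀ i, T.bag (T.child t i) = T.bag t) ∧ (T.bag t).Nonempty

def IsIntroduce (t : T.Node) : Prop :=
  T.arity t = 1 ∧
    ∀ i, T.bag (T.child t i) ⊆ T.bag t ∧ (T.bag t).card = (T.bag (T.child t i)).card + 1

def IsRemove (t : T.Node) : Prop :=
  T.arity t = 1 ∧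
    ∀ i, T.bag t ⊆ T.bag (T.child t i) ∧ (T.bag (T.child t i)).card = (T.bag t).card + 1

/-- `T` is a nice tree decomposition of `G`. -/
structure IsNiceTreeDecomposition (G : (⊤ : SimpleGraph α).Subgraph) : Prop
    extends T.IsTreeDecomposition G where
  node_type : ∀ t, T.IsLeaf t ∨ T.IsJoin t ∨ T.IsIntroduce t ∨ T.IsRemove t
  root_bag : T.bag T.root = ∅
  leaf_bag : ∀ t, T.IsLeaf t → T.bag t = ∅

/-- The bag-program at `t`: the rules all of whose atoms are in the bag. -/
def bagProgram (p : Program α) (t : T.Node) : Program α := p.filter fun r => r.atoms ⊆ T.bag t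

/-- The program below `t`. -/
def programBelow (p : Program α) (t : T.Node) : Program α := (T.below t).biUnion (T.bagProgram p)

/-- The atoms below `t`. -/
def atomsBelow (t : T.Node) : Finset α := (T.below t).biUnion T.bag

/-- Descending along children terminates. -/
theorem isChild_wf : WellFounded T.IsChild := by
  have key : ∀ t, ¬ Relation.TransGen T.IsChild t t := by
    intro t
    have hinj : ∀ a b c, T.IsChild c a → T.IsChild c b → a = b := by
      rintro a b c ⟨i, hi⟩ ⟨j, hj⟩
      have h := @T.child_injective ⟨a, i⟩ ⟨b, j⟩ (hi.symm.trans hj)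
      exact congrArg Sigma.fst h
    induction T.reachable t with
    | refl =>
      intro h
      obtain ⟨b, hb, _⟩ := Relation.TransGen.head'_iff.1 h
      obtain ⟨i, hi⟩ := hb
      exact T.child_ne_root b i hi.symm
    | tail _ hbc ih =>
      rename_i b c _
      intro h
      obtain ⟨d, hd, hdc⟩ := Relation.TransGen.head'_iff.1 h
      have hbd : b = d := hinj _ _ _ hbc hd
      subst hbd
      exact ih (Relation.TransGen.tail' hdc hbc)
  have : IsTrans T.Node (Relation.TransGen T.IsChild) := ⟨fun _ _ _ => Relation.TransGen.trans⟩
  have : Std.Irrefl (Relation.TransGen T.IsChild) := ⟨key⟩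
  exact Subrelation.wf (fun h => Relation.TransGen.single h)
    (Finite.wellFounded_of_trans_of_irrefl (Relation.TransGen T.IsChild))

end BagTree

/-! ### Table algorithms and dynamic programming -/

/-- A table algorithm: from a node `t` of a tree, its bag, a table (rows of type `ι`) from an
earlier traversal, the bag-program at `t` together with the projection atoms, and the tables of the
children of `t`, it computes a table (rows of type `R`) for `t`. -/
abbrev TableAlgorithm (α : Type u) (ι : Type v) (R : Type w) :=
  (T : BagTree α) → (t : T.Node) → Finset α → Finset ι → Program α × Finset α →
    (Fin (T.arity t) → Finset R) → Finset R

section DP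

variable {α : Type u} {ι : Type v} {R : Type w}

/-- Dynamic programming along the tree `T`, bottom-up, with the table algorithm `A` on the
instance `i`, where `inTab` is the table mapping of the input. -/
def dp (A : TableAlgorithm α ι R) (i : Instance α) (T : BagTree α) (inTab : T.Node → Finset ι) :
    T.Node → Finset R :=
  T.isChild_wf.fix fun t rec =>
    A T t (T.bag t) (inTab t) (T.bagProgram i.prog t, i.proj) fun j => rec (T.child t j) ⟨j, rfl⟩

theorem dp_eq (A : TableAlgorithm α ι R) (i : Instance α) (T : BagTree α)
    (inTab : T.Node → Finset ι) (t : T.Node) :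
    dp A i T inTab t = A T t (T.bag t) (inTab t) (T.bagProgram i.prog t, i.proj)
      fun j => dp A i T inTab (T.child t j) :=
  T.isChild_wf.fix_eq _ t

end DP

/-- A row of an algorithm that computes interpretations: the first position is the interpretation
part, the remaining positions (of type `β`) are arbitrary. -/
abbrev Row (α : Type u) (β : Type v) := Finset α × β

/-- A table algorithm for the first traversal. -/
abbrev ConsAlgorithm (α : Type u) (β : Type v) := TableAlgorithm α (Row α β) (Row α β)

section Extensions

variable {α : Type u} {β : Type v} (A : ConsAlgorithm α β) (i : Instance α) (T : BagTree α)

/-- The table mapping obtained by the first traversal, which starts from empty tables. -/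
def consTables : T.Node → Finset (Row α β) := dp A i T fun _ => ∅

/-- The originating rows of the row `r` at `t`: the sequences of rows, one from the table of each
child of `t`, from which (as one-row tables) the algorithm produces a table that contains `r`. -/
def orig (t : T.Node) (r : Row α β) : Finset (Fin (T.arity t) → Row α β) :=
  (Fintype.piFinset fun j => consTables A i T (T.child t j)).filter fun s =>
    r ∈ A T t (T.bag t) ∅ (T.bagProgram i.prog t, i.proj) fun j => {s j}

/-- The originating rows of a table at `t`. -/
def origs (t : T.Node) (ρ : Finset (Row α β)) : Finset (Fin (T.arity t) → Row α β) :=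
  ρ.biUnion (orig A i T t)

/-- `IsExtension A i T t r X`: the set `X` of pairs of a node and a row is an extension below `t`
of the row `r`. -/
inductive IsExtension : T.Node → Row α β → Finset (T.Node × Row α β) → Prop
  | leaf (t : T.Node) (r : Row α β) (ht : T.IsLeaf t) : IsExtension t r {(t, r)}
  | node (t : T.Node) (r : Row α β) (ht : ¬ T.IsLeaf t) (s : Fin (T.arity t) → Row α β)
      (hs : s ∈ orig A i T t r) (X : Fin (T.arity t) → Finset (T.Node × Row α β))
      (hX : ∀ j, IsExtension (T.child t j) (s j) (X j)) :
      IsExtension t r ({(t, r)} ∪ Finset.univ.biUnion X)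

/-- The extensions below `t` of a table. -/
def extensions (t : T.Node) (ρ : Finset (Row α β)) : Set (Finset (T.Node × Row α β)) :=
  {X | ∃ r ∈ ρ, IsExtension A i T t r X}

/-- The family of all extensions: those below the root of the table at the root. -/
def allExtensions : Set (Finset (T.Node × Row α β)) :=
  extensions A i T T.root (consTables A i T T.root)

/-- The satisfiable extensions below `t` of a table: those that are part of an extension at the
root. -/
def satExtensions (t : T.Node) (ρ : Finset (Row α β)) : Set (Finset (T.Node × Row α β)) :=
  {X | X ∈ extensions A i T t ρ ∧ ∃ Y ∈ allExtensions A i T, X ⊆ Y}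

variable {T} in
/-- The local table at `t` of a family of extensions. -/
def localTable (t : T.Node) (E : Set (Finset (T.Node × Row α β))) : Set (Row α β) :=
  {r | ∃ X ∈ E, (t, r) ∈ X}

variable {T} in
/-- The interpretations of a family of extensions. -/
def interpretations (E : Set (Finset (T.Node × Row α β))) : Set (Finset α) :=
  {I | ∃ X ∈ E, I = X.biUnion fun x => x.2.1}

/-- The purged table mapping: at every node, the rows that belong to the local table of the
satisfiable extensions (all such rows are rows of the table computed at this node). -/
def purgedTables (t : T.Node) : Finset (Row α β) :=
  (consTables A i T t).filter fun r =>
    r ∈ localTable t (satExtensions A i T t (consTables A i T t))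

/-- The table algorithm `A` meets the admissibility conditions on the instance `i` and the
decomposition `T`. -/
structure AdmissibleOn : Prop where
  interp_subset_bag : ∀ t, ∀ r ∈ consTables A i T t, r.1 ⊆ T.bag t
  interp_agree : ∀ t, ∀ r ∈ consTables A i T t, ∀ s ∈ orig A i T t r, ∀ j,
    (s j).1 ∩ T.bag (T.child t j) ∩ T.bag t = r.1 ∩ T.bag (T.child t j) ∩ T.bag t
  interp_eq : ∀ t, interpretations (satExtensions A i T t (consTables A i T t)) =
    {I | I ⊆ T.atomsBelow t ∧ IsModel (T.programBelow i.prog t) I ∧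
      ∃ I', IsAnswerSet i.prog I' ∧ I ⊆ I' ∧ I' ⊆ I ∪ (atoms i.prog \ T.atomsBelow t)}
  card_le_one : ∀ t, (t = T.root ∨ T.IsLeaf t) →
    (localTable t (satExtensions A i T t (consTables A i T t))).encard ≤ 1

end Extensions

/-- The table algorithm `A` is admissible for the class `C` of programs: the admissibility
conditions hold for all instances with a program in `C` and all nice tree decompositions of the
primal graph. -/
def Admissible {α : Type u} {β : Type v} (A : ConsAlgorithm α β) (C : Set (Program α)) : Prop :=
  ∀ i : Instance α, i.prog ∈ C → ∀ T : BagTree α,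
    T.IsNiceTreeDecomposition (primalGraph i.prog) → AdmissibleOn A i T

/-! ### Projected counting on the purged tables -/

/-- A row of the projection algorithm: a table and a non-negative integer. -/
abbrev ProjRow (α : Type u) (β : Type v) := Finset (Row α β) × ℕ

section Proj

variable {α : Type u} {β : Type v}

/-- The equivalence classes of rows with the same interpretation part restricted to `P`. -/
def buckets (P : Finset α) (ρ : Finset (Row α β)) : Finset (Finset (Row α β)) :=
  ρ.image fun r => ρ.filter fun r' => r'.1 ∩ P = r.1 ∩ P

/-- The non-empty subsets of the buckets. -/
def subBuckets (P : Finset α) (ρ : Finset (Row α β)) : Finset (Finset (Row α β)) :=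
  (buckets P ρ).biUnion fun B => B.powerset.filter Finset.Nonempty

/-- The stored count of the table `ρ` in `π`. -/
def sipmc (π : Finset (ProjRow α β)) (ρ : Finset (Row α β)) : ℕ :=
  ∑ x ∈ π.filter (fun x => x.1 = ρ), x.2

/-- The stored count of a set `O` of sequences of rows: the product, over the positions, of the
stored counts of the sets of rows of `O` at this position. -/
def sipmcSeq {l : ℕ} (π : Fin l → Finset (ProjRow α β)) (O : Finset (Fin l → Row α β)) : ℕ :=
  ∏ j, sipmc (π j) (O.image fun s => s j)

variable (A : ConsAlgorithm α β) (i : Instance α) (T : BagTree α)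

/-- The projected count of `ρ` at `t`, by inclusion-exclusion on the stored counts of origins. -/
def pmc (t : T.Node) (π : Fin (T.arity t) → Finset (ProjRow α β)) (ρ : Finset (Row α β)) : ℤ :=
  ∑ O ∈ (origs A i T t ρ).powerset.filter Finset.Nonempty,
    (-1) ^ (O.card - 1) * (sipmcSeq π O : ℤ)

/-- The intersection projected count of `ρ` at `t`. -/
def ipmc (t : T.Node) (π : Fin (T.arity t) → Finset (ProjRow α β)) (ρ : Finset (Row α β)) : ℕ :=
  if T.IsLeaf t then 1
  else (pmc A i T t π ρ + ∑ φ ∈ (ρ.ssubsets.filter Finset.Nonempty).attach,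
    (-1) ^ φ.1.card * (ipmc t π φ.1 : ℤ)).natAbs
termination_by ρ.card
decreasing_by
  exact Finset.card_lt_card (Finset.mem_ssubsets.1 (Finset.mem_filter.1 φ.2).1)

end Proj

section MDP

variable {α : Type u} {β : Type v} (A : ConsAlgorithm α β) (i : Instance α) (T : BagTree α)

/-- The table algorithm for projected counting. Origins refer to the first traversal of `A` on the
instance `i`; the table of the earlier traversal is the purged one. -/
def proj : TableAlgorithm α (Row α β) (ProjRow α β) :=
  fun T t _ ν q π => (subBuckets q.2 ν).image fun ρ => (ρ, ipmc A i T t π ρ)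

/-- The table mapping returned by dynamic programming with the projection algorithm on the purged
tabled tree decomposition. -/
def projTables : T.Node → Finset (ProjRow α β) := dp (proj A i) i T (purgedTables A i T)

/-- The whole procedure: decompose the primal graph, run `A`, purge, run the projection algorithm,
and read off the count stored at the root. -/
def mdp (decompose : Program α → BagTree α) : ℕ :=
  ∑ x ∈ projTables A i (decompose i.prog) (decompose i.prog).root, x.2

end MDP

end PAS

end

/-! For a row `r` at a node `t`, let S(r) be the set of all I ∩ P, where I is the interpretation of
a satisfiable extension of `r` below `t` (`projInterps`). The invariant, proved from the leaves
upwards, is that the count stored for a set ρ of rows is the size of the intersection of the S(r)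
with r ∈ ρ (`storesCounts_projTables`).

At an inner node, S(r) is the union, over the origins s of r, of the sets glued from the P-part of r
and one member of each S(s_j) (`projInterps_eq_biUnion`). The members may be chosen independently,
because every extension of a purged row is satisfiable (`IsExtension.satisfiable`). Gluing is
injective: by connectedness of the decomposition and agreement on bags, each part can be read off
from the glued set (`glue_inter_atomsBelow`). So a family of origins contributes the image of a box,
whose size is a product of stored counts, and inclusion-exclusion over origins shows that `pmc` is
the size of the union of the S(r) (`pmc_eq_card_biUnion`). A second inclusion-exclusion, over
subsets of ρ, isolates the intersection up to sign, which is `ipmc` (`ipmc_eq_card_commonPart`).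
Sets of rows that are not stored have empty intersection, so their default count 0 is correct
(`commonPart_eq_empty`).

At the root the purged table has at most one row, and its S consists of the projections of all
answer sets (`biUnion_projInterps_root`). -/

namespace PAS

universe u v

/-! ### Sub-trees and the separation property of bags -/

namespace BagTree

variable {α : Type u} (T : BagTree α)

/-- `T.Desc t s`: the node `s` lies in the sub-tree rooted at `t`. -/
def Desc (t s : T.Node) : Prop := Relation.ReflTransGen (fun a b => T.IsChild b a) t s

variable {T}

theorem mem_below {t s : T.Node} : s ∈ T.below t ↔ T.Desc t s := by
  simp [below, Desc]

theorem Desc.child {t s : T.Node} {j : Fin (T.arity t)} (h : T.Desc (T.child t j) s) :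
    T.Desc t s :=
  Relation.ReflTransGen.head ⟨j, rfl⟩ h

theorem IsChild.parent_unique {a b c : T.Node} (ha : T.IsChild c a) (hb : T.IsChild c b) :
    a = b := by
  obtain ⟨i, hi⟩ := ha
  obtain ⟨j, hj⟩ := hb
  exact congrArg Sigma.fst (@T.child_injective ⟨a, i⟩ ⟨b, j⟩ (hi.symm.trans hj))

/-- A proper descendant is below the parent of which it is a child. -/
theorem Desc.parent {t s p : T.Node} (h : T.Desc t s) (hp : T.IsChild s p) (hne : s ≠ t) :
    T.Desc t p := by
  rcases Relation.ReflTransGen.cases_tail h with rfl | ⟨q, hq, hsq⟩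
  · exact absurd rfl hne
  · rwa [hp.parent_unique hsq]

theorem not_desc_child {t : T.Node} (j : Fin (T.arity t)) : ¬ T.Desc (T.child t j) t := by
  intro h
  have h1 : Relation.TransGen (fun a b => T.IsChild b a) t t :=
    Relation.TransGen.head' ⟨j, rfl⟩ h
  have h2 : Relation.TransGen T.IsChild t t := Relation.transGen_swap.1 h1
  exact T.isChild_wf.transGen.irrefl.irrefl t h2

/-- Climb from `s` towards child `j`. The climb cannot leave the sub-tree of child `k` before child
`j` is reached, since it would have to pass through `t`, which is not below child `j`. -/
theorem desc_child_unique {t s : T.Node} {j k : Fin (T.arity t)} (hj : T.Desc (T.child t j) s)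
    (hk : T.Desc (T.child t k) s) : j = k := by
  induction hj with
  | refl =>
    by_contra hne
    have hne' : T.child t j ≠ T.child t k := fun h =>
      hne (by simpa using @T.child_injective ⟨t, j⟩ ⟨t, k⟩ h)
    exact not_desc_child k (Desc.parent hk ⟨j, rfl⟩ hne')
  | tail hb hc ih =>
    rename_i b c
    by_cases h : c = T.child t k
    · have : b = t := hc.parent_unique ⟨k, h⟩
      exact absurd (this ▸ hb) (not_desc_child j)
    · exact ih (Desc.parent hk hc h)

theorem IsChild.adj {a b : T.Node} (h : T.IsChild b a) : T.graph.Adj a b := by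
  rw [graph, SimpleGraph.fromRel_adj]
  refine ⟨?_, Or.inl h⟩
  rintro rfl
  exact T.isChild_wf.irrefl.irrefl _ h

theorem reachable_root (t : T.Node) : T.graph.Reachable T.root t := by
  induction T.reachable t with
  | refl => exact SimpleGraph.Reachable.refl _
  | tail _ hbc ih => exact ih.trans (IsChild.adj hbc).reachable

/-- A walk that leaves the sub-tree rooted at a child passes through the child and its parent. -/
theorem walk_leaves_subtree {t : T.Node} (j : Fin (T.arity t)) {x y : T.Node}
    (q : T.graph.Walk x y) (hx : T.Desc (T.child t j) x) (hy : ¬ T.Desc (T.child t j) y) :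
    T.child t j ∈ q.support ∧ t ∈ q.support := by
  induction q with
  | nil => exact absurd hx hy
  | cons hadj q ih =>
    rename_i a b c
    by_cases hb : T.Desc (T.child t j) b
    · have := ih hb hy
      simp [this]
    · rw [graph, SimpleGraph.fromRel_adj] at hadj
      -- An edge out of the sub-tree must go from a node to its parent, and only the top node has
      -- its parent outside.
      rcases hadj.2 with h | h
      · exact absurd (Relation.ReflTransGen.tail hx h) hb
      · by_cases ha : a = T.child t j
        · have hbt : b = t := h.parent_unique ⟨j, ha⟩
          subst hbt
          simp [← ha]
        · exact absurd (Desc.parent hx h ha) hb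

/-- An atom that occurs inside and outside the sub-tree rooted at a child is in the bags of the
child and of its parent. -/
theorem IsTreeDecomposition.mem_bag_of_separated {G : (⊤ : SimpleGraph α).Subgraph}
    (hT : T.IsTreeDecomposition G) {t : T.Node} (j : Fin (T.arity t)) {x y : T.Node} {a : α}
    (hx : T.Desc (T.child t j) x) (hy : ¬ T.Desc (T.child t j) y) (hax : a ∈ T.bag x)
    (hay : a ∈ T.bag y) : a ∈ T.bag (T.child t j) ∧ a ∈ T.bag t := by
  obtain ⟨q, hq⟩ := ((reachable_root x).symm.trans (reachable_root y)).exists_isPath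
  have h := walk_leaves_subtree j q hx hy
  exact ⟨hT.path_inter x _ y q hq h.1 (Finset.mem_inter.2 ⟨hax, hay⟩),
    hT.path_inter x _ y q hq h.2 (Finset.mem_inter.2 ⟨hax, hay⟩)⟩

theorem mem_atomsBelow {t : T.Node} {a : α} :
    a ∈ T.atomsBelow t ↔ ∃ s, T.Desc t s ∧ a ∈ T.bag s := by
  simp [atomsBelow, mem_below]

theorem bag_subset_atomsBelow (t : T.Node) : T.bag t ⊆ T.atomsBelow t := fun _ ha =>
  mem_atomsBelow.2 ⟨t, Relation.ReflTransGen.refl, ha⟩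

theorem atomsBelow_child_subset (t : T.Node) (j : Fin (T.arity t)) :
    T.atomsBelow (T.child t j) ⊆ T.atomsBelow t := fun _ ha => by
  obtain ⟨s, hs, has⟩ := mem_atomsBelow.1 ha
  exact mem_atomsBelow.2 ⟨s, hs.child, has⟩

/-- The node `t` lies outside the sub-tree of its child, so the occurrence in its bag is separated
from the one below. -/
theorem IsTreeDecomposition.mem_bag_child {G : (⊤ : SimpleGraph α).Subgraph}
    (hT : T.IsTreeDecomposition G) {t : T.Node} {j : Fin (T.arity t)} {a : α}
    (ha : a ∈ T.atomsBelow (T.child t j)) (hat : a ∈ T.bag t) : a ∈ T.bag (T.child t j) := by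
  obtain ⟨s, hs, has⟩ := mem_atomsBelow.1 ha
  exact (hT.mem_bag_of_separated j hs (not_desc_child j) has hat).1

/-- Sub-trees of distinct children are disjoint, so the two occurrences are separated by `t`. -/
theorem IsTreeDecomposition.mem_bag_of_mem_children {G : (⊤ : SimpleGraph α).Subgraph}
    (hT : T.IsTreeDecomposition G) {t : T.Node} {j k : Fin (T.arity t)} (hjk : j ≠ k) {a : α}
    (hj : a ∈ T.atomsBelow (T.child t j)) (hk : a ∈ T.atomsBelow (T.child t k)) :
    a ∈ T.bag t := by
  obtain ⟨x, hx, hax⟩ := mem_atomsBelow.1 hj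
  obtain ⟨y, hy, hay⟩ := mem_atomsBelow.1 hk
  exact (hT.mem_bag_of_separated j hx (fun h => hjk (desc_child_unique h hy)) hax hay).2

theorem atomsBelow_root {p : Program α} (hT : T.IsTreeDecomposition (primalGraph p)) :
    T.atomsBelow T.root = atoms p := by
  ext a
  have h : (∃ t, a ∈ T.bag t) ↔ a ∈ atoms p := by
    have := Set.ext_iff.1 hT.bags_cover a
    exact this
  rw [← h, mem_atomsBelow]
  exact ⟨fun ⟨s, _, hs⟩ => ⟨s, hs⟩, fun ⟨s, hs⟩ => ⟨s, T.reachable s, hs⟩⟩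

theorem programBelow_subset (p : Program α) (t : T.Node) : T.programBelow p t ⊆ p := by
  intro r hr
  obtain ⟨s, _, hs⟩ := Finset.mem_biUnion.1 hr
  exact (Finset.mem_filter.1 hs).1

end BagTree

/-! ### Answer sets -/

section AnswerSets

variable {α : Type u} {p : Program α} {I : Finset α}

/-- Rules that the reduct drops are satisfied through their negative bodies. -/
theorem IsAnswerSet.isModel (h : IsAnswerSet p I) : IsModel p I := by
  intro r hr
  by_cases hn : r.neg ∩ I = ∅
  · have hmem : r.positive ∈ reduct p I :=
      Finset.mem_image.2 ⟨r, Finset.mem_filter.2 ⟨hr, hn⟩, rfl⟩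
    rcases h.1 _ hmem with h' | h'
    · left
      refine h'.mono (Finset.inter_subset_inter_right ?_)
      simp [Rule.positive]
    · exact Or.inr h'
  · left
    exact (Finset.nonempty_iff_ne_empty.2 hn).mono
      (Finset.inter_subset_inter_right Finset.subset_union_right)

/-- By minimality: deleting atoms foreign to the program still leaves a model of the reduct. -/
theorem IsAnswerSet.subset_atoms (h : IsAnswerSet p I) : I ⊆ atoms p := by
  by_contra hsub
  have hlt : I ∩ atoms p ⊂ I := by
    refine (Finset.inter_subset_left).ssubset_of_ne fun he => hsub ?_
    rw [← he]
    exact Finset.inter_subset_right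
  refine h.2 _ hlt fun r hr => ?_
  obtain ⟨r', hr', rfl⟩ := Finset.mem_image.1 hr
  have hat : r'.atoms ⊆ atoms p :=
    Finset.subset_biUnion_of_mem Rule.atoms (Finset.mem_filter.1 hr').1
  rcases h.1 _ hr with ⟨a, ha⟩ | h'
  · left
    refine ⟨a, ?_⟩
    simp only [Rule.positive, Finset.union_empty, Finset.mem_inter] at ha ⊢
    exact ⟨ha.1, ha.2, hat (by simp [Rule.atoms, ha.1])⟩
  · right
    exact h'.mono (Finset.sdiff_subset_sdiff subset_rfl Finset.inter_subset_left)

/-- Since `J` avoids the projection atoms, the counted set is recovered from the answer set by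
intersecting; conversely `J` is the rest of the answer set. -/
theorem projectedCount_eq_card_image (i : Instance α) :
    projectedCount i =
      (((atoms i.prog).powerset.filter (IsAnswerSet i.prog)).image (· ∩ i.proj)).card := by
  unfold projectedCount
  congr 1
  ext K
  simp only [Finset.mem_filter, Finset.mem_powerset, Finset.mem_image]
  constructor
  · rintro ⟨hK, J, hJ, hans⟩
    refine ⟨K ∪ J, ⟨hans.subset_atoms, hans⟩, ?_⟩
    ext a
    have := @hJ a
    have := @hK a
    simp only [Finset.mem_sdiff, Finset.mem_inter, Finset.mem_union] at *
    tauto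
  · rintro ⟨I, ⟨hI, hans⟩, rfl⟩
    refine ⟨Finset.inter_subset_right, I \ i.proj,
      Finset.sdiff_subset_sdiff hI subset_rfl, ?_⟩
    have : I ∩ i.proj ∪ I \ i.proj = I := by
      ext a
      simp only [Finset.mem_sdiff, Finset.mem_inter, Finset.mem_union]
      tauto
    rwa [this]

end AnswerSets

end PAS

noncomputable section

namespace PAS

universe u v w

/-! ### Inclusion-exclusion -/

section InclusionExclusion

variable {κ : Type u} {γ : Type v} {δ : Type w}

/-- The intersection of a non-empty finite family of finite sets (empty for the empty family). -/
def commonPart (ρ : Finset κ) (S : κ → Finset γ) : Finset γ :=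
  (ρ.biUnion S).filter fun x => ∀ r ∈ ρ, x ∈ S r

theorem mem_commonPart {ρ : Finset κ} {S : κ → Finset γ} (hρ : ρ.Nonempty) {x : γ} :
    x ∈ commonPart ρ S ↔ ∀ r ∈ ρ, x ∈ S r := by
  simp only [commonPart, Finset.mem_filter, Finset.mem_biUnion, and_iff_right_iff_imp]
  intro h
  obtain ⟨r, hr⟩ := hρ
  exact ⟨r, hr, h r hr⟩

/-- Used twice at each inner node: for families of origins and for sets of rows. -/
theorem card_biUnion_eq_sum_commonPart [DecidableEq γ] (ρ : Finset κ) (S : κ → Finset γ) :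
    ((ρ.biUnion S).card : ℤ) = ∑ φ ∈ ρ.powerset.filter Finset.Nonempty,
      (-1) ^ (φ.card + 1) * ((commonPart φ S).card : ℤ) := by
  rw [Finset.inclusion_exclusion_card_biUnion, Finset.univ_eq_attach,
    ← Finset.sum_attach (ρ.powerset.filter Finset.Nonempty)]
  refine Finset.sum_congr rfl fun φ _ => ?_
  have hφ : φ.1.Nonempty := (Finset.mem_filter.1 φ.2).2
  congr 3
  ext x
  simp [Finset.mem_inf', mem_commonPart hφ]

/-- The intersection of a family of images of boxes under a map that is injective on their union
is in bijection with the product of the intersections of the sides. -/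
theorem card_commonPart_image_piFinset {l : ℕ} [DecidableEq δ] [DecidableEq κ]
    (S : Fin l → κ → Finset γ) (Φ : (Fin l → γ) → δ) {O : Finset (Fin l → κ)} (hO : O.Nonempty)
    (hinj : ∀ s ∈ O, ∀ s' ∈ O, ∀ K ∈ Fintype.piFinset fun j => S j (s j),
      ∀ K' ∈ Fintype.piFinset fun j => S j (s' j), Φ K = Φ K' → K = K') :
    (commonPart O fun s => (Fintype.piFinset fun j => S j (s j)).image Φ).card =
      ∏ j, (commonPart (O.image fun s => s j) (S j)).card := by
  -- Intersections of boxes are taken coordinatewise.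
  have hmem : ∀ K, (K ∈ Fintype.piFinset fun j => commonPart (O.image fun s => s j) (S j)) ↔
      ∀ s ∈ O, K ∈ Fintype.piFinset fun j => S j (s j) := by
    intro K
    simp only [Fintype.mem_piFinset, mem_commonPart (hO.image _), Finset.forall_mem_image]
    exact ⟨fun h s hs j => h j hs, fun h j s hs => h s hs j⟩
  rw [← Fintype.card_piFinset, ← Finset.card_image_of_injOn (f := Φ)]
  · congr 1
    ext x
    simp only [mem_commonPart hO, Finset.mem_image, hmem]
    constructor
    · intro h
      obtain ⟨s₀, hs₀⟩ := hO
      obtain ⟨K, hK, rfl⟩ := h s₀ hs₀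
      refine ⟨K, fun s hs => ?_, rfl⟩
      -- Injectivity forces the preimages in all the boxes to coincide.
      obtain ⟨K', hK', he⟩ := h s hs
      rwa [← hinj s hs s₀ hs₀ K' hK' K hK he]
    · rintro ⟨K, hK, rfl⟩ s hs
      exact ⟨K, hK s hs, rfl⟩
  · intro K hK K' hK' he
    obtain ⟨s₀, hs₀⟩ := hO
    exact hinj s₀ hs₀ s₀ hs₀ K ((hmem K).1 hK s₀ hs₀) K' ((hmem K').1 hK' s₀ hs₀) he

end InclusionExclusion

/-! ### Extensions -/

section Extensions

variable {α : Type u} {β : Type v} {A : ConsAlgorithm α β} {i : Instance α} {T : BagTree α}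

/-- The interpretation of a set of pairs of a node and a row. -/
def interp (X : Finset (T.Node × Row α β)) : Finset α := X.biUnion fun x => x.2.1

theorem interp_node (t : T.Node) (r : Row α β) {l : ℕ}
    (X : Fin l → Finset (T.Node × Row α β)) :
    interp ({(t, r)} ∪ Finset.univ.biUnion X) =
      r.1 ∪ Finset.univ.biUnion fun j => interp (X j) := by
  ext a
  simp only [interp, Finset.mem_biUnion, Finset.mem_union, Finset.mem_singleton,
    Finset.mem_univ, true_and]
  constructor
  · rintro ⟨x, rfl | ⟨j, hj⟩, ha⟩
    · exact Or.inl ha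
    · exact Or.inr ⟨j, x, hj, ha⟩
  · rintro (ha | ⟨j, x, hj, ha⟩)
    · exact ⟨(t, r), Or.inl rfl, ha⟩
    · exact ⟨x, Or.inr ⟨j, hj⟩, ha⟩

theorem mem_orig {t : T.Node} {r : Row α β} {s : Fin (T.arity t) → Row α β}
    (hs : s ∈ orig A i T t r) (j : Fin (T.arity t)) : s j ∈ consTables A i T (T.child t j) :=
  Fintype.mem_piFinset.1 (Finset.mem_filter.1 hs).1 j

theorem IsExtension.mem_self {t : T.Node} {r : Row α β} {X : Finset (T.Node × Row α β)}
    (h : IsExtension A i T t r X) : (t, r) ∈ X := by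
  cases h <;> simp

/-- In an extension, the part below an occurring pair may be exchanged. -/
theorem IsExtension.exchange {t t' : T.Node} {r r' : Row α β}
    {Y X : Finset (T.Node × Row α β)} (hY : IsExtension A i T t r Y) (hmem : (t', r') ∈ Y)
    (hX : IsExtension A i T t' r' X) : ∃ Y', IsExtension A i T t r Y' ∧ X ⊆ Y' := by
  induction hY with
  | leaf t r ht =>
    obtain ⟨rfl, rfl⟩ := Prod.mk.inj (Finset.mem_singleton.1 hmem)
    exact ⟨X, hX, subset_rfl⟩
  | node t r ht s hs Z hZ ih =>
    rcases Finset.mem_union.1 hmem with h | h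
    · obtain ⟨rfl, rfl⟩ := Prod.mk.inj (Finset.mem_singleton.1 h)
      exact ⟨X, hX, subset_rfl⟩
    · obtain ⟨j, _, hj⟩ := Finset.mem_biUnion.1 h
      obtain ⟨Y', hY', hsub⟩ := ih j hj
      -- Only the branch that contains the pair is replaced; the chosen origin stays the same.
      refine ⟨_, IsExtension.node t r ht s hs (Function.update Z j Y') fun k => ?_, ?_⟩
      · by_cases hk : k = j
        · subst hk
          simpa using hY'
        · simpa [hk] using hZ k
      · intro x hx
        refine Finset.mem_union_right _ (Finset.mem_biUnion.2 ⟨j, Finset.mem_univ _, ?_⟩)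
        simpa using hsub hx

theorem mem_consTables_of_mem_purgedTables {t : T.Node} {r : Row α β}
    (h : r ∈ purgedTables A i T t) : r ∈ consTables A i T t :=
  (Finset.mem_filter.1 h).1

theorem IsExtension.mem_purgedTables {t : T.Node} {r : Row α β}
    {X Y : Finset (T.Node × Row α β)} (hr : r ∈ consTables A i T t)
    (h : IsExtension A i T t r X) (hY : Y ∈ allExtensions A i T) (hXY : X ⊆ Y) :
    r ∈ purgedTables A i T t :=
  Finset.mem_filter.2 ⟨hr, X, ⟨⟨r, hr, h⟩, Y, hY, hXY⟩, h.mem_self⟩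

/-- Satisfiability depends only on the row: in an extension at the root that contains the pair, the
part below it can be exchanged for any other extension of the row. -/
theorem IsExtension.satisfiable {t : T.Node} {r : Row α β} {X : Finset (T.Node × Row α β)}
    (h : IsExtension A i T t r X) (hr : r ∈ purgedTables A i T t) :
    ∃ Y ∈ allExtensions A i T, X ⊆ Y := by
  obtain ⟨Z, ⟨_, Y, ⟨r', hr', hY⟩, hZY⟩, hZ⟩ := (Finset.mem_filter.1 hr).2
  obtain ⟨Y', hY', hsub⟩ := hY.exchange (hZY hZ) h
  exact ⟨Y', ⟨r', hr', hY'⟩, hsub⟩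

/-! ### Projected interpretations of a row -/

variable (A i T)

/-- The restrictions to the projection atoms of the interpretations of the satisfiable extensions
of a row. -/
def projInterps (t : T.Node) (r : Row α β) : Finset (Finset α) :=
  i.proj.powerset.filter fun K => ∃ X ∈ satExtensions A i T t {r}, K = interp X ∩ i.proj

variable {A i T}

theorem mem_projInterps {t : T.Node} {r : Row α β} {K : Finset α} :
    K ∈ projInterps A i T t r ↔ ∃ X Y, IsExtension A i T t r X ∧ Y ∈ allExtensions A i T ∧
      X ⊆ Y ∧ K = interp X ∩ i.proj := by
  simp only [projInterps, satExtensions, extensions, Finset.mem_filter, Finset.mem_powerset,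
    Set.mem_ofPred_eq, Finset.mem_singleton, exists_eq_left]
  constructor
  · rintro ⟨_, X, ⟨hX, Y, hY, hXY⟩, hK⟩
    exact ⟨X, Y, hX, hY, hXY, hK⟩
  · rintro ⟨X, Y, hX, hY, hXY, rfl⟩
    exact ⟨Finset.inter_subset_right, X, ⟨hX, Y, hY, hXY⟩, rfl⟩

theorem mem_purgedTables_of_mem_projInterps {t : T.Node} {r : Row α β} {K : Finset α}
    (hr : r ∈ consTables A i T t) (hK : K ∈ projInterps A i T t r) :
    r ∈ purgedTables A i T t := by
  obtain ⟨X, Y, hX, hY, hXY, _⟩ := mem_projInterps.1 hK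
  exact hX.mem_purgedTables hr hY hXY

theorem mem_projInterps_of_mem_purgedTables {t : T.Node} {r : Row α β} {K : Finset α}
    (hr : r ∈ purgedTables A i T t) :
    K ∈ projInterps A i T t r ↔ ∃ X, IsExtension A i T t r X ∧ K = interp X ∩ i.proj := by
  rw [mem_projInterps]
  constructor
  · rintro ⟨X, Y, hX, _, _, hK⟩
    exact ⟨X, hX, hK⟩
  · rintro ⟨X, hX, hK⟩
    obtain ⟨Y, hY, hXY⟩ := hX.satisfiable hr
    exact ⟨X, Y, hX, hY, hXY, hK⟩

/-- Glue projected interpretations at the children to one at their parent. -/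
def glue {l : ℕ} (Q : Finset α) (K : Fin l → Finset α) : Finset α := Q ∪ Finset.univ.biUnion K

/-- Parts of a satisfiable extension are satisfiable. Conversely, arbitrary extensions of the rows
of one origin combine to an extension of `r`, which is satisfiable because `r` is purged. -/
theorem projInterps_eq_biUnion {t : T.Node} (ht : ¬ T.IsLeaf t) {r : Row α β}
    (hr : r ∈ purgedTables A i T t) :
    projInterps A i T t r = (orig A i T t r).biUnion fun s =>
      (Fintype.piFinset fun j => projInterps A i T (T.child t j) (s j)).image
        (glue (r.1 ∩ i.proj)) := by
  have hglue : ∀ Z : Fin (T.arity t) → Finset (T.Node × Row α β),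
      glue (r.1 ∩ i.proj) (fun j => interp (Z j) ∩ i.proj) =
        interp ({(t, r)} ∪ Finset.univ.biUnion Z) ∩ i.proj := by
    intro Z
    rw [interp_node]
    ext a
    simp only [glue, Finset.mem_union, Finset.mem_inter, Finset.mem_biUnion, Finset.mem_univ,
      true_and]
    constructor
    · rintro (h | ⟨j, h1, h2⟩)
      · exact ⟨Or.inl h.1, h.2⟩
      · exact ⟨Or.inr ⟨j, h1⟩, h2⟩
    · rintro ⟨h | ⟨j, h1⟩, h2⟩
      · exact Or.inl ⟨h, h2⟩
      · exact Or.inr ⟨j, h1, h2⟩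
  ext K
  simp only [mem_projInterps_of_mem_purgedTables hr, Finset.mem_biUnion, Finset.mem_image,
    Fintype.mem_piFinset]
  constructor
  · rintro ⟨X, hX, rfl⟩
    obtain ⟨Y, hY, hXY⟩ := hX.satisfiable hr
    cases hX with
    | leaf _ _ h => exact absurd h ht
    | node _ _ _ s hs Z hZ =>
      refine ⟨s, hs, fun j => interp (Z j) ∩ i.proj, fun j => ?_, hglue Z⟩
      refine mem_projInterps.2 ⟨Z j, Y, hZ j, hY, subset_trans ?_ hXY, rfl⟩
      exact (Finset.subset_biUnion_of_mem Z (Finset.mem_univ j)).trans Finset.subset_union_right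
  · rintro ⟨s, hs, K', hK', rfl⟩
    choose Z Y hZ hY hZY he using fun j => mem_projInterps.1 (hK' j)
    refine ⟨_, IsExtension.node t r ht s hs Z hZ, ?_⟩
    rw [← hglue Z]
    congr 1
    exact funext he

/-! ### Interpretations of extensions -/

theorem IsExtension.interp_subset_atomsBelow (hA : AdmissibleOn A i T) {t : T.Node}
    {r : Row α β} {X : Finset (T.Node × Row α β)} (h : IsExtension A i T t r X)
    (hr : r ∈ consTables A i T t) : interp X ⊆ T.atomsBelow t := by
  induction h with
  | leaf t r ht =>
    simpa [interp] using (hA.interp_subset_bag t r hr).trans (T.bag_subset_atomsBelow t)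
  | node t r ht s hs Z hZ ih =>
    rw [interp_node]
    refine Finset.union_subset ((hA.interp_subset_bag t r hr).trans (T.bag_subset_atomsBelow t))
      (Finset.biUnion_subset.2 fun j _ => ?_)
    exact (ih j (mem_orig hs j)).trans (BagTree.atomsBelow_child_subset t j)

theorem IsExtension.subset_interp {t : T.Node} {r : Row α β} {X : Finset (T.Node × Row α β)}
    (h : IsExtension A i T t r X) : r.1 ⊆ interp X :=
  Finset.subset_biUnion_of_mem (fun x : T.Node × Row α β => x.2.1) h.mem_self

/-- An atom of the bag that comes from below a child is in the child's bag by connectedness, hence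
in the child's row by induction, hence in `r` by agreement of `r` with its origin. -/
theorem IsExtension.interp_inter_bag {G : (⊤ : SimpleGraph α).Subgraph}
    (hT : T.IsTreeDecomposition G) (hA : AdmissibleOn A i T) {t : T.Node}
    {r : Row α β} {X : Finset (T.Node × Row α β)} (h : IsExtension A i T t r X)
    (hr : r ∈ consTables A i T t) : interp X ∩ T.bag t = r.1 := by
  refine subset_antisymm ?_
    (Finset.subset_inter h.subset_interp (hA.interp_subset_bag t r hr))
  induction h with
  | leaf t r ht => simp [interp]
  | node t r ht s hs Z hZ ih =>
    rw [interp_node]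
    intro a ha
    obtain ⟨ha, hat⟩ := Finset.mem_inter.1 ha
    rcases Finset.mem_union.1 ha with ha | ha
    · exact ha
    · obtain ⟨j, _, haj⟩ := Finset.mem_biUnion.1 ha
      have hsj := mem_orig hs j
      have hab := hT.mem_bag_child ((hZ j).interp_subset_atomsBelow hA hsj haj) hat
      have has := ih j hsj (Finset.mem_inter.2 ⟨haj, hab⟩)
      have := hA.interp_agree t r hr s hs j
      have hmem : a ∈ (s j).1 ∩ T.bag (T.child t j) ∩ T.bag t := by simp [has, hab, hat]
      rw [this] at hmem
      exact (Finset.mem_inter.1 (Finset.mem_inter.1 hmem).1).1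

/-! ### Recovering the parts of a glued set -/

section

variable {G : (⊤ : SimpleGraph α).Subgraph}

theorem subset_atomsBelow_of_mem_projInterps (hA : AdmissibleOn A i T) {t : T.Node}
    {r : Row α β} {K : Finset α} (hr : r ∈ consTables A i T t)
    (hK : K ∈ projInterps A i T t r) : K ⊆ T.atomsBelow t := by
  obtain ⟨X, _, hX, _, _, rfl⟩ := mem_projInterps.1 hK
  exact Finset.inter_subset_left.trans (hX.interp_subset_atomsBelow hA hr)

theorem inter_bag_of_mem_projInterps (hT : T.IsTreeDecomposition G) (hA : AdmissibleOn A i T)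
    {t : T.Node} {r : Row α β} {K : Finset α} (hr : r ∈ consTables A i T t)
    (hK : K ∈ projInterps A i T t r) : K ∩ T.bag t = r.1 ∩ i.proj := by
  obtain ⟨X, _, hX, _, _, rfl⟩ := mem_projInterps.1 hK
  rw [Finset.inter_right_comm, hX.interp_inter_bag hT hA hr]

/-- A glued set determines its parts. -/
theorem glue_inter_atomsBelow (hT : T.IsTreeDecomposition G) (hA : AdmissibleOn A i T)
    {t : T.Node} {r : Row α β} (hr : r ∈ consTables A i T t) {s : Fin (T.arity t) → Row α β}
    (hs : s ∈ orig A i T t r) {K : Fin (T.arity t) → Finset α}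
    (hK : ∀ j, K j ∈ projInterps A i T (T.child t j) (s j)) (j : Fin (T.arity t)) :
    glue (r.1 ∩ i.proj) K ∩ T.atomsBelow (T.child t j) = K j := by
  have hsub : ∀ k, K k ⊆ T.atomsBelow (T.child t k) := fun k =>
    subset_atomsBelow_of_mem_projInterps hA (mem_orig hs k) (hK k)
  -- On the atoms shared by the bags of `t` and a child, the part at this child is dictated by `r`.
  have hagree : ∀ k a, a ∈ T.bag (T.child t k) → a ∈ T.bag t →
      (a ∈ K k ↔ a ∈ r.1 ∩ i.proj) := by
    intro k a hak hat
    have h1 := Finset.ext_iff.1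
      (inter_bag_of_mem_projInterps hT hA (mem_orig hs k) (hK k)) a
    have h2 := Finset.ext_iff.1 (hA.interp_agree t r hr s hs k) a
    simp only [Finset.mem_inter, hak, hat, and_true] at h1 h2 ⊢
    rw [h1, h2]
  ext a
  simp only [glue, Finset.mem_inter, Finset.mem_union, Finset.mem_biUnion, Finset.mem_univ,
    true_and]
  constructor
  · rintro ⟨h | ⟨k, hk⟩, ha⟩
    · have hat := hA.interp_subset_bag t r hr h.1
      exact (hagree j a (hT.mem_bag_child ha hat) hat).2 (Finset.mem_inter.2 h)
    · by_cases hkj : k = j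
      · exact hkj ▸ hk
      · have hat := hT.mem_bag_of_mem_children hkj (hsub k hk) ha
        have hmem := (hagree k a (hT.mem_bag_child (hsub k hk) hat) hat).1 hk
        exact (hagree j a (hT.mem_bag_child ha hat) hat).2 hmem
  · intro h
    exact ⟨Or.inr ⟨j, h⟩, hsub j h⟩

end

end Extensions

end PAS

end

noncomputable section

namespace PAS

universe u v w

/-! ### Correctness of the projection algorithm -/

section Counting

variable {α : Type u} {β : Type v} {A : ConsAlgorithm α β} {i : Instance α} {T : BagTree α}

theorem mem_subBuckets {P : Finset α} {ν ρ : Finset (Row α β)} :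
    ρ ∈ subBuckets P ν ↔ ρ.Nonempty ∧ ρ ⊆ ν ∧ ∀ r ∈ ρ, ∀ r' ∈ ρ, r.1 ∩ P = r'.1 ∩ P := by
  simp only [subBuckets, buckets, Finset.mem_biUnion, Finset.mem_image, Finset.mem_filter,
    Finset.mem_powerset]
  constructor
  · rintro ⟨_, ⟨r₀, hr₀, rfl⟩, hsub, hne⟩
    refine ⟨hne, hsub.trans (Finset.filter_subset _ _), fun r hr r' hr' => ?_⟩
    rw [(Finset.mem_filter.1 (hsub hr)).2, (Finset.mem_filter.1 (hsub hr')).2]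
  · rintro ⟨hne, hsub, h⟩
    obtain ⟨r₀, hr₀⟩ := id hne
    exact ⟨_, ⟨r₀, hsub hr₀, rfl⟩,
      fun r hr => Finset.mem_filter.2 ⟨hsub hr, h r hr r₀ hr₀⟩, hne⟩

theorem projTables_eq (t : T.Node) :
    projTables A i T t = (subBuckets i.proj (purgedTables A i T t)).image fun ρ =>
      (ρ, ipmc A i T t (fun j => projTables A i T (T.child t j)) ρ) := by
  unfold projTables
  rw [dp_eq]
  rfl

/-- Each table is stored at most once, so the sum has at most one term; a missing table counts 0. -/
theorem sipmc_image (B : Finset (Finset (Row α β))) (f : Finset (Row α β) → ℕ)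
    (ρ : Finset (Row α β)) :
    sipmc (B.image fun ρ => (ρ, f ρ)) ρ = if ρ ∈ B then f ρ else 0 := by
  unfold sipmc
  rw [Finset.sum_filter, Finset.sum_image fun x _ y _ h => (Prod.mk.inj h).1]
  simp

/-- The table `π` for `t` stores, for every non-empty set of rows, the number of common projected
interpretations. -/
def StoresCounts (A : ConsAlgorithm α β) (i : Instance α) (T : BagTree α) (t : T.Node)
    (π : Finset (ProjRow α β)) : Prop :=
  ∀ ρ : Finset (Row α β), ρ.Nonempty → ρ ⊆ consTables A i T t →
    sipmc π ρ = (commonPart ρ (projInterps A i T t)).card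

variable {G : (⊤ : SimpleGraph α).Subgraph}

/-- The gluing map depends on the row only through its P-part, which is constant on a bucket. One
map thus serves all origins of `ρ`, and an origin shared by several rows yields the same sets for
each of them. -/
theorem pmc_eq_card_biUnion (hT : T.IsTreeDecomposition G) (hA : AdmissibleOn A i T)
    {t : T.Node} (ht : ¬ T.IsLeaf t) {π : Fin (T.arity t) → Finset (ProjRow α β)}
    (hπ : ∀ j, StoresCounts A i T (T.child t j) (π j)) {ρ : Finset (Row α β)}
    (hρ : ρ ∈ subBuckets i.proj (purgedTables A i T t)) :
    pmc A i T t π ρ = ((ρ.biUnion (projInterps A i T t)).card : ℤ) := by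
  obtain ⟨hne, hsub, hbucket⟩ := mem_subBuckets.1 hρ
  obtain ⟨r₀, hr₀⟩ := hne
  have hunion : ρ.biUnion (projInterps A i T t) = (origs A i T t ρ).biUnion fun s =>
      (Fintype.piFinset fun j => projInterps A i T (T.child t j) (s j)).image
        (glue (r₀.1 ∩ i.proj)) := by
    rw [origs, Finset.biUnion_biUnion]
    refine Finset.biUnion_congr rfl fun r hr => ?_
    rw [projInterps_eq_biUnion ht (hsub hr), hbucket r hr r₀ hr₀]
  rw [hunion, card_biUnion_eq_sum_commonPart, pmc]
  refine Finset.sum_congr rfl fun O hO => ?_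
  obtain ⟨hO, hOne⟩ := Finset.mem_filter.1 hO
  have hO := Finset.mem_powerset.1 hO
  have horig : ∀ s ∈ O, ∃ r ∈ ρ, s ∈ orig A i T t r := fun s hs =>
    Finset.mem_biUnion.1 (hO hs)
  -- As `O` is non-empty, the truncated subtraction does not change the parity.
  have hsign : (-1 : ℤ) ^ (O.card - 1) = (-1) ^ (O.card + 1) := by
    obtain ⟨n, hn⟩ : ∃ n, O.card = n + 1 := Nat.exists_eq_succ_of_ne_zero hOne.card_pos.ne'
    rw [hn, Nat.add_sub_cancel, pow_succ, pow_succ]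
    ring
  have hpart : ∀ s ∈ O, ∀ K ∈ Fintype.piFinset fun j => projInterps A i T (T.child t j) (s j),
      ∀ j, glue (r₀.1 ∩ i.proj) K ∩ T.atomsBelow (T.child t j) = K j := by
    intro s hs K hK j
    obtain ⟨r, hr, hsr⟩ := horig s hs
    rw [hbucket r₀ hr₀ r hr]
    exact glue_inter_atomsBelow hT hA (mem_consTables_of_mem_purgedTables (hsub hr)) hsr
      (Fintype.mem_piFinset.1 hK) j
  rw [card_commonPart_image_piFinset (fun j => projInterps A i T (T.child t j)) _ hOne, hsign,
    sipmcSeq]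
  · congr 2
    -- The rows of `O` at position `j` need not share a bucket or survive purging; the invariant
    -- covers every non-empty subset of the child's table.
    refine Finset.prod_congr rfl fun j _ => hπ j _ (hOne.image _) ?_
    intro x hx
    obtain ⟨s, hs, rfl⟩ := Finset.mem_image.1 hx
    obtain ⟨r, _, hsr⟩ := horig s hs
    exact mem_orig hsr j
  · intro s hs s' hs' K hK K' hK' he
    funext j
    rw [← hpart s hs K hK j, he, hpart s' hs' K' hK' j]

/-- Expand the size of the union by inclusion-exclusion over subsets of `ρ`. By strong induction the
proper subsets cancel against the recursive sum, and the absolute value removes the sign of the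
remaining term. -/
theorem ipmc_eq_card_commonPart (hT : T.IsTreeDecomposition G) (hA : AdmissibleOn A i T)
    {t : T.Node} (ht : ¬ T.IsLeaf t) {π : Fin (T.arity t) → Finset (ProjRow α β)}
    (hπ : ∀ j, StoresCounts A i T (T.child t j) (π j)) (ρ : Finset (Row α β))
    (hρ : ρ ∈ subBuckets i.proj (purgedTables A i T t)) :
    ipmc A i T t π ρ = (commonPart ρ (projInterps A i T t)).card := by
  induction ρ using Finset.strongInduction with
  | H ρ ih =>
    obtain ⟨hne, hsub, hbucket⟩ := mem_subBuckets.1 hρ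
    have hrec : ∑ φ ∈ (ρ.ssubsets.filter Finset.Nonempty).attach,
        (-1) ^ φ.1.card * (ipmc A i T t π φ.1 : ℤ) =
        ∑ φ ∈ ρ.ssubsets.filter Finset.Nonempty,
          (-1) ^ φ.card * ((commonPart φ (projInterps A i T t)).card : ℤ) := by
      rw [← Finset.sum_attach (ρ.ssubsets.filter Finset.Nonempty)]
      refine Finset.sum_congr rfl fun φ _ => ?_
      obtain ⟨hφ, hφne⟩ := Finset.mem_filter.1 φ.2
      have hφ := Finset.mem_ssubsets.1 hφ
      rw [ih φ.1 hφ (mem_subBuckets.2 ⟨hφne, hφ.subset.trans hsub,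
        fun r hr r' hr' => hbucket r (hφ.subset hr) r' (hφ.subset hr')⟩)]
    have hsplit : ρ.powerset.filter Finset.Nonempty =
        insert ρ (ρ.ssubsets.filter Finset.Nonempty) := by
      ext φ
      simp only [Finset.mem_filter, Finset.mem_powerset, Finset.mem_insert, Finset.mem_ssubsets]
      constructor
      · rintro ⟨h, hφ⟩
        rcases h.eq_or_ssubset with h | h
        · exact Or.inl h
        · exact Or.inr ⟨h, hφ⟩
      · rintro (rfl | ⟨h, hφ⟩)
        · exact ⟨subset_rfl, hne⟩
        · exact ⟨h.subset, hφ⟩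
    have hnot : ρ ∉ ρ.ssubsets.filter Finset.Nonempty := by simp
    rw [ipmc, if_neg ht, hrec, pmc_eq_card_biUnion hT hA ht hπ hρ,
      card_biUnion_eq_sum_commonPart, hsplit, Finset.sum_insert hnot, add_assoc,
      ← Finset.sum_add_distrib, Finset.sum_eq_zero, add_zero, Int.natAbs_mul, Int.natAbs_pow]
    · simp
    · intro φ _
      rw [pow_succ]
      ring

/-- Leaf bags are empty, so the empty set is the only projected interpretation of a purged row. -/
theorem card_commonPart_of_isLeaf {p : Program α}
    (hT : T.IsNiceTreeDecomposition (primalGraph p)) (hA : AdmissibleOn A i T)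
    {t : T.Node} (ht : T.IsLeaf t) {ρ : Finset (Row α β)} (hne : ρ.Nonempty)
    (hsub : ρ ⊆ purgedTables A i T t) :
    (commonPart ρ (projInterps A i T t)).card = 1 := by
  refine Finset.card_eq_one.2 ⟨∅, ?_⟩
  have hrow : ∀ r ∈ ρ, projInterps A i T t r = {∅} := by
    intro r hr
    have hempty : r.1 = ∅ := by
      have := hA.interp_subset_bag t r (mem_consTables_of_mem_purgedTables (hsub hr))
      rwa [hT.leaf_bag t ht, Finset.subset_empty] at this
    ext K
    rw [mem_projInterps_of_mem_purgedTables (hsub hr), Finset.mem_singleton]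
    constructor
    · rintro ⟨X, hX, rfl⟩
      cases hX with
      | leaf => simp [interp, hempty]
      | node _ _ h => exact absurd ht h
    · rintro rfl
      exact ⟨_, IsExtension.leaf t r ht, by simp [interp, hempty]⟩
  ext K
  rw [mem_commonPart hne, Finset.mem_singleton]
  obtain ⟨r₀, hr₀⟩ := hne
  constructor
  · intro h
    simpa [hrow r₀ hr₀] using h r₀ hr₀
  · rintro rfl r hr
    simp [hrow r hr]

/-- A common projected interpretation would show that every row survives purging, and its trace on
the bag would put all the rows into one bucket. -/
theorem commonPart_eq_empty (hT : T.IsTreeDecomposition G) (hA : AdmissibleOn A i T)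
    {t : T.Node} {ρ : Finset (Row α β)} (hne : ρ.Nonempty) (hsub : ρ ⊆ consTables A i T t)
    (hρ : ρ ∉ subBuckets i.proj (purgedTables A i T t)) :
    commonPart ρ (projInterps A i T t) = ∅ := by
  refine Finset.eq_empty_of_forall_notMem fun K hK => hρ ?_
  rw [mem_commonPart hne] at hK
  refine mem_subBuckets.2 ⟨hne,
    fun r hr => mem_purgedTables_of_mem_projInterps (hsub hr) (hK r hr),
    fun r hr r' hr' => ?_⟩
  rw [← inter_bag_of_mem_projInterps hT hA (hsub hr) (hK r hr),
    inter_bag_of_mem_projInterps hT hA (hsub hr') (hK r' hr')]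

/-- The stored counts are the numbers of common projected interpretations. -/
theorem storesCounts_projTables {p : Program α}
    (hT : T.IsNiceTreeDecomposition (primalGraph p)) (hA : AdmissibleOn A i T) (t : T.Node) :
    StoresCounts A i T t (projTables A i T t) := by
  induction t using T.isChild_wf.induction with
  | _ t ih =>
    intro ρ hne hsub
    rw [projTables_eq, sipmc_image]
    split_ifs with hρ
    · by_cases ht : T.IsLeaf t
      · rw [ipmc, if_pos ht,
          card_commonPart_of_isLeaf hT hA ht hne (mem_subBuckets.1 hρ).2.1]
      · exact ipmc_eq_card_commonPart hT.toIsTreeDecomposition hA ht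
          (fun j => ih (T.child t j) ⟨j, rfl⟩) ρ hρ
    · rw [commonPart_eq_empty hT.toIsTreeDecomposition hA hne hsub hρ, Finset.card_empty]

/-! ### The root -/

/-- All atoms are below the root, so no atoms remain by which the answer set could exceed `I`. -/
theorem interpretations_root (hT : T.IsTreeDecomposition (primalGraph i.prog))
    (hA : AdmissibleOn A i T) :
    interpretations (satExtensions A i T T.root (consTables A i T T.root)) =
      {I | IsAnswerSet i.prog I} := by
  rw [hA.interp_eq, BagTree.atomsBelow_root hT]
  ext I
  simp only [Finset.sdiff_self, Finset.union_empty, Set.mem_ofPred_eq]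
  constructor
  · rintro ⟨_, _, I', hI', h1, h2⟩
    rwa [subset_antisymm h1 h2]
  · intro hI
    exact ⟨hI.subset_atoms, fun r hr => hI.isModel r (BagTree.programBelow_subset _ _ hr), I, hI,
      subset_rfl, subset_rfl⟩

theorem biUnion_projInterps_root (hT : T.IsTreeDecomposition (primalGraph i.prog))
    (hA : AdmissibleOn A i T) :
    (purgedTables A i T T.root).biUnion (projInterps A i T T.root) =
      ((atoms i.prog).powerset.filter (IsAnswerSet i.prog)).image (· ∩ i.proj) := by
  have hroot : ∀ I, IsAnswerSet i.prog I ↔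
      ∃ X ∈ satExtensions A i T T.root (consTables A i T T.root), I = interp X := fun I =>
    (Set.ext_iff.1 (interpretations_root hT hA) I).symm
  ext K
  simp only [Finset.mem_biUnion, Finset.mem_image, Finset.mem_filter, Finset.mem_powerset,
    mem_projInterps]
  constructor
  · rintro ⟨r, hr, X, Y, hX, hY, hXY, rfl⟩
    have hans := (hroot (interp X)).2
      ⟨X, ⟨⟨r, mem_consTables_of_mem_purgedTables hr, hX⟩, Y, hY, hXY⟩, rfl⟩
    exact ⟨interp X, ⟨hans.subset_atoms, hans⟩, rfl⟩
  · rintro ⟨I, ⟨_, hans⟩, rfl⟩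
    obtain ⟨X, ⟨⟨r, hr, hX⟩, Y, hY, hXY⟩, rfl⟩ := (hroot I).1 hans
    exact ⟨r, hX.mem_purgedTables hr hY hXY, X, Y, hX, hY, hXY, rfl⟩

theorem card_purgedTables_root (hA : AdmissibleOn A i T) :
    (purgedTables A i T T.root).card ≤ 1 := by
  refine Finset.card_le_one.2 fun r hr r' hr' => ?_
  exact Set.encard_le_one_iff.1 (hA.card_le_one T.root (Or.inl rfl)) r r'
    (Finset.mem_filter.1 hr).2 (Finset.mem_filter.1 hr').2

theorem subBuckets_of_card_le_one {P : Finset α} {ν : Finset (Row α β)} (hν : ν.card ≤ 1) :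
    subBuckets P ν = ({ν} : Finset (Finset (Row α β))).filter Finset.Nonempty := by
  ext ρ
  rw [mem_subBuckets, Finset.mem_filter, Finset.mem_singleton]
  constructor
  · rintro ⟨hne, hsub, _⟩
    exact ⟨Finset.eq_of_subset_of_card_le hsub (hν.trans hne.card_pos), hne⟩
  · rintro ⟨rfl, hne⟩
    exact ⟨hne, subset_rfl, fun r hr r' hr' => by rw [Finset.card_le_one.1 hν r hr r' hr']⟩

/-- With at most one purged row there is at most one sub-bucket, so nothing is counted twice. -/
theorem sum_projTables_root (hA : AdmissibleOn A i T) :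
    ∑ x ∈ projTables A i T T.root, x.2 =
      sipmc (projTables A i T T.root) (purgedTables A i T T.root) := by
  rw [sipmc, Finset.filter_true_of_mem]
  intro x hx
  rw [projTables_eq, subBuckets_of_card_le_one (card_purgedTables_root hA)] at hx
  obtain ⟨ρ, hρ, rfl⟩ := Finset.mem_image.1 hx
  exact Finset.mem_singleton.1 (Finset.mem_filter.1 hρ).1

theorem sipmc_projTables_root (hT : T.IsNiceTreeDecomposition (primalGraph i.prog))
    (hA : AdmissibleOn A i T) :
    sipmc (projTables A i T T.root) (purgedTables A i T T.root) = projectedCount i := by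
  rw [projectedCount_eq_card_image, ← biUnion_projInterps_root hT.toIsTreeDecomposition hA]
  have hcard := card_purgedTables_root hA
  rcases (purgedTables A i T T.root).eq_empty_or_nonempty with h | h
  -- Sub-buckets are non-empty, so an empty root table has stored count 0, which matches the empty
  -- union.
  · rw [projTables_eq, sipmc_image, if_neg fun hmem => (mem_subBuckets.1 hmem).1.ne_empty h, h]
    simp
  · rw [storesCounts_projTables hT hA T.root _ h fun _ => mem_consTables_of_mem_purgedTables]
    -- For a single row, intersection and union agree.
    congr 1
    obtain ⟨r, hr⟩ := Finset.card_eq_one.1 (le_antisymm hcard h.card_pos)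
    ext K
    simp [mem_commonPart, hr]

end Counting

end PAS

end

/-! ### Correctness on an instance and for a class of programs -/

theorem mainTheorem6 {α : Type*} {β : Type*} (A : PAS.ConsAlgorithm α β) :
    (∀ (i : PAS.Instance α) (T : PAS.BagTree α),
      T.IsNiceTreeDecomposition (PAS.primalGraph i.prog) → PAS.AdmissibleOn A i T →
        PAS.sipmc (PAS.projTables A i T T.root) (PAS.purgedTables A i T T.root) =
            PAS.projectedCount i ∧
        ∑ x ∈ PAS.projTables A i T T.root, x.2 = PAS.projectedCount i) ∧
    (∀ C : Set (PAS.Program α), PAS.Admissible A C →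
      ∀ decompose : PAS.Program α → PAS.BagTree α,
        (∀ p ∈ C, (decompose p).IsNiceTreeDecomposition (PAS.primalGraph p)) →
          ∀ i : PAS.Instance α, i.prog ∈ C →
            PAS.mdp A i decompose = PAS.projectedCount i) := by
  have key : ∀ (i : PAS.Instance α) (T : PAS.BagTree α),
      T.IsNiceTreeDecomposition (PAS.primalGraph i.prog) → PAS.AdmissibleOn A i T →
        PAS.sipmc (PAS.projTables A i T T.root) (PAS.purgedTables A i T T.root) =
            PAS.projectedCount i ∧
        ∑ x ∈ PAS.projTables A i T T.root, x.2 = PAS.projectedCount i := fun i T hT hA =>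
    ⟨PAS.sipmc_projTables_root hT hA,
      (PAS.sum_projTables_root hA).trans (PAS.sipmc_projTables_root hT hA)⟩
  exact ⟨key, fun C hC decompose hdec i hi =>
    (key i (decompose i.prog) (hdec _ hi) (hC i hi _ (hdec _ hi))).2⟩
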